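/- Consider the box-basket-ball system. A site is a triple $(a,b,c)$ of non-negative integers with $a+c=b+1$ (one box, $b$ baskets, $c$ balls, and room for $a$ further balls), and the vacuum is $V=(1,0,0)$. A state is a sequence of sites $(S_i)_{i\in\mathbb Z}$ with $S_i=V$ for all but finitely many $i$. For $\ell\ge 1$ or $\ell=\infty$, the time evolution $T_\ell$ is given by a carrier that starts in the state $(\ell,0,0)$ far on the left and passes all sites from left to right. When a carrier in state $(a,b,c)$ passes a site in state $(d,e,f)$, put $$X=\min(a+b,a+c,b+f),\quad Y=\min(e+c,d+c,d+b),\quad Z=\min(a+e,d+f,e+f);$$ the new state of the site is $(d+X-Y,\;e+X-Z,\;f+Y-Z)$ and the new state of the carrier is $(a-X+Y,\;b-X+Z,\;c-Y+Z)$. Let $F=(0,0,1)$ and $B_k=(k+1,k,0)$ for $k\ge1$. For $m\ge1$ let $F_m=FF\cdots F$ ($m$ letters), and for $r\ge1$ and $a_1,\dots,a_r\ge1$ let $B_{a_1,\dots,a_r}=B_{a_1}B_{a_2}\cdots B_{a_r}$. For finite words $A,A'$ of sites, write $$A[0]\ast A'[0]\longrightarrow A'[\delta']\ast A[\delta]\qquad\text{under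 }T_\ell$$ if $A$ and $A'$, each alone in the vacuum, are translated by $T_\ell$ by constant velocities $v$ and $v'$ respectively, and the following holds for every state $p=\cdots VV\,A\,V\cdots V\,A'\,VV\cdots$ in which $A$ and $A'$ are separated by at least $v$ vacuum sites, with leftmost letters of $A$ and $A'$ at positions $x$ and $x'$: for all sufficiently large $N$, $T_\ell^N(p)$ has the form $\cdots VV\,A'\,V\cdots V\,A\,VV\cdots$, with leftmost letters of $A'$ and $A$ at positions $x'+Nv'+\delta'$ and $x+Nv+\delta$ respectively. **Statement.** Let $m\ge2$, $r\ge1$, $a_1,\dots,a_r\ge1$, and let $a=a_1+\cdots+a_r$ be the total number of baskets in $B_{a_1,\dots,a_r}$. Then, for every $\ell$ with $2\le\ell\le\infty$, $$F_m[0]\ast B_{a_1,\dots,a_r}[0]\longrightarrow B_{a_1,\dots,a_r}[-1]\ast F_m[-a]\qquad\text{under }T_\ell .$$ -/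

import Mathlib

namespace BoxBasketBall

/-- The state of a site: one box, `b` baskets and `c` balls. Each ball occupies a box or a basket,
so that `c ≤ b + 1`, and `a = b - c + 1` is the number of extra balls that can fit. -/
@[ext]
structure Site where
  a : ℕ
  b : ℕ
  c : ℕ
  capacity : a + c = b + 1

/-- The vacuum `V = (1,0,0)`. -/
def V : Site := ⟨1, 0, 0, rfl⟩

/-- The site `F = (0,0,1)`: one ball in the box and no basket. -/
def F : Site := ⟨0, 0, 1, rfl⟩

/-- The site `B_k = (k+1,k,0)`: `k` empty baskets and an empty box. -/
def B (k : ℕ) : Site := ⟨k + 1, k, 0, rfl⟩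

/-- A state of the system: a sequence of sites indexed by `ℤ`, equal to the vacuum for `i ≪ 0` and
for `i ≫ 0`. -/
@[ext]
structure State where
  site : ℤ → Site
  vacuum_left : ∃ n : ℤ, ∀ i < n, site i = V
  vacuum_right : ∃ n : ℤ, ∀ i ≥ n, site i = V

/-- The state `(a,b,c)` of a carrier. The first entry is infinite for the carrier of unlimited
capacity. -/
@[ext]
structure Carrier where
  a : ℕ∞
  b : ℕ
  c : ℕ

/-- The carrier `u_ℓ = (ℓ,0,0)`. -/
def u (ℓ : ℕ∞) : Carrier := ⟨ℓ, 0, 0⟩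

/-- `min(a+b, a+c, b+f)` for a carrier `(a,b,c)` and a site `(d,e,f)` (always finite; it is `b+f`
when `a = ∞`). -/
noncomputable def minX (C : Carrier) (S : Site) : ℕ :=
  (min (C.a + C.b) (min (C.a + C.c) ((C.b : ℕ∞) + S.c))).toNat

/-- `min(e+c, d+c, d+b)` for a carrier `(a,b,c)` and a site `(d,e,f)`. -/
def minY (C : Carrier) (S : Site) : ℕ :=
  min (S.b + C.c) (min (S.a + C.c) (S.a + C.b))

/-- `min(a+e, d+f, e+f)` for a carrier `(a,b,c)` and a site `(d,e,f)` (always finite; it is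
`min(d,e)+f` when `a = ∞`). -/
noncomputable def minZ (C : Carrier) (S : Site) : ℕ :=
  (min (C.a + S.b) (min ((S.a : ℕ∞) + S.c) ((S.b : ℕ∞) + S.c))).toNat

theorem minX_of_finite (n b c : ℕ) (S : Site) :
    minX ⟨n, b, c⟩ S = min (n + b) (min (n + c) (b + S.c)) := by
  have h : min ((n : ℕ∞) + b) (min ((n : ℕ∞) + c) ((b : ℕ∞) + S.c))
      = ((min (n + b) (min (n + c) (b + S.c)) : ℕ) : ℕ∞) := by
    norm_cast
  simp only [minX, h, ENat.toNat_natCast]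

theorem minZ_of_finite (n b c : ℕ) (S : Site) :
    minZ ⟨n, b, c⟩ S = min (n + S.b) (min (S.a + S.c) (S.b + S.c)) := by
  have h : min ((n : ℕ∞) + S.b) (min ((S.a : ℕ∞) + S.c) ((S.b : ℕ∞) + S.c))
      = ((min (n + S.b) (min (S.a + S.c) (S.b + S.c)) : ℕ) : ℕ∞) := by
    norm_cast
  simp only [minZ, h, ENat.toNat_natCast]

theorem minX_of_top (b c : ℕ) (S : Site) : minX ⟨⊤, b, c⟩ S = b + S.c := by
  have h : min ((⊤ : ℕ∞) + b) (min ((⊤ : ℕ∞) + c) ((b : ℕ∞) + S.c)) = ((b + S.c : ℕ) : ℕ∞) := by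
    simp
  simp only [minX, h, ENat.toNat_natCast]

theorem minZ_of_top (b c : ℕ) (S : Site) : minZ ⟨⊤, b, c⟩ S = min (S.a + S.c) (S.b + S.c) := by
  have h : min ((⊤ : ℕ∞) + S.b) (min ((S.a : ℕ∞) + S.c) ((S.b : ℕ∞) + S.c))
      = ((min (S.a + S.c) (S.b + S.c) : ℕ) : ℕ∞) := by
    rw [top_add, min_eq_right le_top]
    norm_cast
  simp only [minZ, h, ENat.toNat_natCast]

theorem siteAfter_capacity (C : Carrier) (S : Site) :
    (S.a + minX C S - minY C S) + (S.c + minY C S - minZ C S)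
      = (S.b + minX C S - minZ C S) + 1 := by
  have hS := S.capacity
  obtain ⟨a, b, c⟩ := C
  induction a with
  | top => rw [minX_of_top, minZ_of_top]; simp only [minY]; omega
  | coe n => rw [minX_of_finite, minZ_of_finite]; simp only [minY]; omega

/-- The state `(d',e',f')` of a site `(d,e,f)` after the carrier `(a,b,c)` has passed:
`d' = d + min(a+b,a+c,b+f) - min(e+c,d+c,d+b)`,
`e' = e + min(a+b,a+c,b+f) - min(a+e,d+f,e+f)`,
`f' = f + min(e+c,d+c,d+b) - min(a+e,d+f,e+f)`. None of the subtractions truncates. -/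
noncomputable def siteAfter (C : Carrier) (S : Site) : Site where
  a := S.a + minX C S - minY C S
  b := S.b + minX C S - minZ C S
  c := S.c + minY C S - minZ C S
  capacity := siteAfter_capacity C S

/-- The state `(a',b',c')` of the carrier `(a,b,c)` after passing a site `(d,e,f)`:
`a' = a - min(a+b,a+c,b+f) + min(e+c,d+c,d+b)`,
`b' = b - min(a+b,a+c,b+f) + min(a+e,d+f,e+f)`,
`c' = c - min(e+c,d+c,d+b) + min(a+e,d+f,e+f)`.
None of the subtractions truncates, and `a' = ∞` if `a = ∞`. -/
noncomputable def carrierAfter (C : Carrier) (S : Site) : Carrier where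
  a := C.a + minY C S - minX C S
  b := C.b + minZ C S - minX C S
  c := C.c + minZ C S - minY C S

/-- The carrier that starts as `u_ℓ` at site `n`, after it has passed the `k` sites
`n, n+1, …, n+k-1`. -/
noncomputable def carrierFrom (ℓ : ℕ∞) (S : ℤ → Site) (n : ℤ) : ℕ → Carrier
  | 0 => u ℓ
  | k + 1 => carrierAfter (carrierFrom ℓ S n k) (S (n + k))

/-- The carrier arriving at site `i`, having started as `u_ℓ` far on the left. As `u_ℓ` and `V` do
not change each other, it can be taken to start at any site before which all sites are vacuum. -/
noncomputable def carrierAt (ℓ : ℕ∞) (S : State) (i : ℤ) : Carrier :=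
  carrierFrom ℓ S.site S.vacuum_left.choose (i - S.vacuum_left.choose).toNat

theorem u_V (ℓ : ℕ∞) : siteAfter (u ℓ) V = V ∧ carrierAfter (u ℓ) V = u ℓ := by
  induction ℓ with
  | top =>
    simp only [siteAfter, carrierAfter, u, minX_of_top, minZ_of_top, minY, V, Site.ext_iff,
      Carrier.ext_iff]
    simp
  | coe n =>
    simp only [siteAfter, carrierAfter, u, minX_of_finite, minZ_of_finite, minY, V, Site.ext_iff,
      Carrier.ext_iff]
    simp

theorem carrierAfter_capacity (ℓ : ℕ∞) (C : Carrier) (S : Site) (h : C.a + C.c = C.b + ℓ) :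
    (carrierAfter C S).a + (carrierAfter C S).c = (carrierAfter C S).b + ℓ := by
  have hS := S.capacity
  obtain ⟨a, b, c⟩ := C
  induction a with
  | top =>
    have hl : ℓ = ⊤ := by
      induction ℓ with
      | top => rfl
      | coe l => exact absurd h (by simp only [top_add]; exact_mod_cast ENat.top_ne_natCast _)
    subst hl
    simp [carrierAfter]
  | coe n =>
    induction ℓ with
    | top => exact absurd h (by simp only [add_top]; exact_mod_cast ENat.natCast_ne_top _)
    | coe l =>
      have h' : n + c = b + l := by
        dsimp only at h
        exact_mod_cast h
      simp only [carrierAfter, minX_of_finite, minZ_of_finite, minY]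
      norm_cast
      omega

theorem carrierFrom_capacity (ℓ : ℕ∞) (S : ℤ → Site) (n : ℤ) (k : ℕ) :
    (carrierFrom ℓ S n k).a + (carrierFrom ℓ S n k).c = (carrierFrom ℓ S n k).b + ℓ := by
  induction k with
  | zero => simp [carrierFrom, u]
  | succ k ih => exact carrierAfter_capacity ℓ _ _ ih

/-- In the vacuum a carrier drops its baskets, and drops a ball if it carries one. -/
theorem carrierAfter_V (ℓ : ℕ∞) (C : Carrier) (h : C.a + C.c = C.b + ℓ) :
    (carrierAfter C V).b = 0 ∧ (carrierAfter C V).c = C.c - min C.c (C.b + 1) := by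
  obtain ⟨a, b, c⟩ := C
  induction a with
  | top => simp only [carrierAfter, minX_of_top, minZ_of_top, minY, V]; omega
  | coe n =>
    induction ℓ with
    | top => exact absurd h (by simp only [add_top]; exact_mod_cast ENat.natCast_ne_top _)
    | coe l =>
      have h' : n + c = b + l := by
        dsimp only at h
        exact_mod_cast h
      simp only [carrierAfter, minX_of_finite, minZ_of_finite, minY, V]
      omega

theorem carrierFrom_eventually (ℓ : ℕ∞) (S : State) (n : ℤ) :
    ∃ K : ℕ, ∀ k ≥ K, carrierFrom ℓ S.site n k = u ℓ := by
  obtain ⟨r, hr⟩ := S.vacuum_right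
  have hV : ∀ k ≥ (r - n).toNat, S.site (n + k) = V := fun k hk => hr _ (by omega)
  have hc : ∀ j : ℕ, (carrierFrom ℓ S.site n ((r - n).toNat + j)).c
      ≤ (carrierFrom ℓ S.site n (r - n).toNat).c - j := by
    intro j
    induction j with
    | zero => simp
    | succ j ih =>
      have := (carrierAfter_V ℓ _ (carrierFrom_capacity ℓ S.site n ((r - n).toNat + j))).2
      rw [← add_assoc, carrierFrom, hV _ (by omega), this]
      omega
  refine ⟨(r - n).toNat + (carrierFrom ℓ S.site n (r - n).toNat).c + 1, fun k hk => ?_⟩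
  obtain ⟨j, rfl⟩ := Nat.exists_eq_add_of_le (show (r - n).toNat + 1 ≤ k by omega)
  have hs : carrierFrom ℓ S.site n ((r - n).toNat + 1 + j)
      = carrierAfter (carrierFrom ℓ S.site n ((r - n).toNat + j)) V := by
    rw [add_right_comm, carrierFrom, hV _ (by omega)]
  have hb := (carrierAfter_V ℓ _ (carrierFrom_capacity ℓ S.site n ((r - n).toNat + j))).1
  rw [← hs] at hb
  have h0 := hc (1 + j)
  rw [← add_assoc] at h0
  have h1 : (carrierFrom ℓ S.site n ((r - n).toNat + 1 + j)).c = 0 := by omega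
  have h2 := carrierFrom_capacity ℓ S.site n ((r - n).toNat + 1 + j)
  rw [hb, h1] at h2
  refine Carrier.ext ?_ hb h1
  simpa [u] using h2

/-- The time evolution `T_ℓ`, for `ℓ ∈ ℕ ∪ {∞}`: a carrier that starts as `u_ℓ` far on the left
passes all sites from left to right. -/
noncomputable def T (ℓ : ℕ∞) (S : State) : State where
  site i := siteAfter (carrierAt ℓ S i) (S.site i)
  vacuum_left := by
    refine ⟨S.vacuum_left.choose, fun i hi => ?_⟩
    have : (i - S.vacuum_left.choose).toNat = 0 := by omega
    rw [carrierAt, this, S.vacuum_left.choose_spec i hi]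
    exact (u_V ℓ).1
  vacuum_right := by
    obtain ⟨K, hK⟩ := carrierFrom_eventually ℓ S S.vacuum_left.choose
    obtain ⟨r, hr⟩ := S.vacuum_right
    refine ⟨max r (S.vacuum_left.choose + K), fun i hi => ?_⟩
    rw [carrierAt, hK _ (by omega), hr i (by omega)]
    exact (u_V ℓ).1

/-- The state `⋯ V V A V V ⋯` that consists of the finite word `A` of sites, with its leftmost
letter at position `x`, and of vacuum elsewhere. -/
def place (A : List Site) (x : ℤ) : State where
  site i := if x ≤ i then A.getD (i - x).toNat V else V
  vacuum_left := ⟨x, fun i hi => if_neg (by omega)⟩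
  vacuum_right := ⟨x + A.length, fun i hi => by
    rw [if_pos (by omega), List.getD_eq_default _ _ (by omega)]⟩

/-- The word `A V ⋯ V A'` with `g` vacuum sites between `A` and `A'`. -/
def separated (A : List Site) (g : ℕ) (A' : List Site) : List Site :=
  A ++ List.replicate g V ++ A'

/-- Under the time evolution `T`, the word `A` on its own propagates freely with velocity `v`. -/
def HasVelocity (T : State → State) (A : List Site) (v : ℤ) : Prop :=
  ∀ x : ℤ, T (place A x) = place A (x + v)

/-- The scattering `A[0] * A'[0] ⟶ A'[δ'] * A[δ]` under the time evolution `T`.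

With `v` and `v'` the velocities of the free propagations of `A` and `A'`, start from any state
`⋯ A ⋯ A' ⋯` in which `A` is separated from `A'` by at least `v` vacuum sites, with leftmost letters
at positions `x` and `x'`. For all sufficiently large `N`, the state after `N` steps is
`⋯ A' ⋯ A ⋯`, with leftmost letters at `x' + N v' + δ'` and `x + N v + δ`. -/
def Scatters (T : State → State) (A A' : List Site) (δ' δ : ℤ) : Prop :=
  ∃ v v' : ℤ, HasVelocity T A v ∧ HasVelocity T A' v' ∧
    ∀ (x x' : ℤ) (g : ℕ), v ≤ g → x' = x + A.length + g →
      ∃ N₀ : ℕ, ∀ N ≥ N₀, ∃ g' : ℕ,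
        x + N * v + δ = (x' + N * v' + δ') + A'.length + g' ∧
        T^[N] (place (separated A g A') x) = place (separated A' g' A) (x' + N * v' + δ')

/-- The fast soliton `F_m = F F ⋯ F` (`m` letters). -/
def fastSoliton (m : ℕ) : List Site := List.replicate m F

/-- The pure basket soliton `B_{a₁,…,a_r} = B_{a₁} ⋯ B_{a_r}`. -/
def basketSoliton (as : List ℕ) : List Site := as.map B

end BoxBasketBall

namespace BoxBasketBall

/-! The carrier of level 0 gives one more evolution, `T 0`, which commutes with every `T ℓ`
(`T_comm`). Under `T 0` a fast soliton rests while a basket soliton still has velocity 1, so here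
the baskets overtake the balls from the left. The given state, with its baskets on the right, is
therefore the result of M steps of `T 0` from a state with the baskets on the left, one vacuum site
before the balls (`iterate_zero_basket_fast`). On that state `T ℓ` only drives the two solitons
apart, as min(ℓ, m) ≥ 2 exceeds 1 (`iterate_basket_fast`). By commutation, N steps of `T ℓ` on the
given state amount to M steps of `T 0` on the separated one, and for N ≥ M these only bring the
baskets nearer, without a collision (`iterate_zero_approach`). The displacements -1 and -a are those
of the `T 0` collision, undone.

Commutation is a Yang-Baxter argument: far to the left the two carriers scatter trivially, and the
scattering relation `Cross` is preserved at every site (`Cross.after`).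

The `T 0` collision is computed with space and time exchanged: each site is followed through all
time, while a list of bags passes it. The row of baskets absorbs balls at the fast soliton; in the
vacuum behind, the window of filled baskets slides along the row, and balls drop out once it reaches
the end. So the balls move by a sites, and the outgoing bags are those of a free basket soliton
started one site further right. -/

/-- The carrier `(p, p + q, q)` of level `0`. -/
def bag (p q : ℕ) : Carrier := ⟨p, p + q, q⟩

theorem u_zero : u 0 = bag 0 0 := by simp [u, bag]

/-! ### Local rules for a carrier passing a site -/

/-- Additive equations replace the subtractions of the rule, so that linear arithmetic never meets
truncation. -/
theorem after_finite (n b c : ℕ) (S : Site) :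
    ∃ X Y Z a' b' c' : ℕ, X = min (n + b) (min (n + c) (b + S.c)) ∧
      Y = min (S.b + c) (min (S.a + c) (S.a + b)) ∧
      Z = min (n + S.b) (min (S.a + S.c) (S.b + S.c)) ∧
      carrierAfter ⟨n, b, c⟩ S = ⟨a', b', c'⟩ ∧
      a' + X = n + Y ∧ b' + X = b + Z ∧ c' + Y = c + Z ∧
      (siteAfter ⟨n, b, c⟩ S).a + Y = S.a + X ∧
      (siteAfter ⟨n, b, c⟩ S).b + Z = S.b + X ∧
      (siteAfter ⟨n, b, c⟩ S).c + Z = S.c + Y := by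
  have hS := S.capacity
  refine ⟨minX ⟨n, b, c⟩ S, minY ⟨n, b, c⟩ S, minZ ⟨n, b, c⟩ S, ?_, ?_, ?_,
    minX_of_finite n b c S, rfl, minZ_of_finite n b c S, ?_⟩
  · exact n + minY ⟨n, b, c⟩ S - minX ⟨n, b, c⟩ S
  · exact b + minZ ⟨n, b, c⟩ S - minX ⟨n, b, c⟩ S
  · exact c + minZ ⟨n, b, c⟩ S - minY ⟨n, b, c⟩ S
  refine ⟨?_, ?_⟩
  · simp [carrierAfter]
  · simp only [siteAfter, minX_of_finite, minZ_of_finite, minY]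
    refine ⟨?_, ?_, ?_, ?_, ?_, ?_⟩ <;> omega

theorem after_top (b c : ℕ) (S : Site) :
    ∃ X Y Z b' c' : ℕ, X = b + S.c ∧
      Y = min (S.b + c) (min (S.a + c) (S.a + b)) ∧
      Z = min (S.a + S.c) (S.b + S.c) ∧
      carrierAfter ⟨⊤, b, c⟩ S = ⟨⊤, b', c'⟩ ∧
      b' + X = b + Z ∧ c' + Y = c + Z ∧
      (siteAfter ⟨⊤, b, c⟩ S).a + Y = S.a + X ∧
      (siteAfter ⟨⊤, b, c⟩ S).b + Z = S.b + X ∧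
      (siteAfter ⟨⊤, b, c⟩ S).c + Z = S.c + Y := by
  have hS := S.capacity
  refine ⟨minX ⟨⊤, b, c⟩ S, minY ⟨⊤, b, c⟩ S, minZ ⟨⊤, b, c⟩ S, ?_, ?_,
    minX_of_top b c S, rfl, minZ_of_top b c S, ?_⟩
  · exact b + minZ ⟨⊤, b, c⟩ S - minX ⟨⊤, b, c⟩ S
  · exact c + minZ ⟨⊤, b, c⟩ S - minY ⟨⊤, b, c⟩ S
  refine ⟨?_, ?_⟩
  · simp [carrierAfter]
  · simp only [siteAfter, minX_of_top, minZ_of_top, minY]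
    refine ⟨?_, ?_, ?_, ?_, ?_⟩ <;> omega

/-- Read `bag p q` as p empty and q filled baskets, and let a site that has balls keep one of them
in its box. With the box empty, bag and site exchange all baskets. -/
theorem bag_after_empty (p q e : ℕ) (S : Site) (hb : S.b = e) (hc : S.c = 0) :
    carrierAfter (bag p q) S = bag e 0 ∧ (siteAfter (bag p q) S).a = p + 1 ∧
      (siteAfter (bag p q) S).b = p + q ∧ (siteAfter (bag p q) S).c = q := by
  have hS := S.capacity
  obtain ⟨X, Y, Z, a', b', c', hX, hY, hZ, h, h1, h2, h3, h4, h5, h6⟩ := after_finite p (p + q) q S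
  replace hX : X = p + q := by omega
  replace hY : Y = q + e := by omega
  replace hZ : Z = e := by omega
  subst hX hY hZ
  rw [bag, h, bag]
  simp only [Carrier.ext_iff, Nat.cast_inj]
  refine ⟨⟨?_, ?_, ?_⟩, ?_, ?_, ?_⟩ <;> omega

/-- Having no empty basket, the bag must leave the ball in the box; the baskets are exchanged. -/
theorem bag_after_full (q d f : ℕ) (S : Site) (ha : S.a = d) (hc : S.c = f + 1) :
    carrierAfter (bag 0 q) S = bag d f ∧ (siteAfter (bag 0 q) S).a = 0 ∧
      (siteAfter (bag 0 q) S).b = q ∧ (siteAfter (bag 0 q) S).c = q + 1 := by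
  have hS := S.capacity
  obtain ⟨X, Y, Z, a', b', c', hX, hY, hZ, h, h1, h2, h3, h4, h5, h6⟩ := after_finite 0 (0 + q) q S
  replace hX : X = q := by omega
  replace hY : Y = d + q := by omega
  replace hZ : Z = S.b := by omega
  subst hX hY hZ
  rw [bag, h, bag]
  simp only [Carrier.ext_iff, Nat.cast_inj]
  refine ⟨⟨?_, ?_, ?_⟩, ?_, ?_, ?_⟩ <;> omega

/-- The bag keeps one empty basket to carry off the ball in the box; all other baskets are
exchanged. -/
theorem bag_after_swap (p q d f : ℕ) (S : Site) (ha : S.a = d) (hc : S.c = f + 1) :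
    carrierAfter (bag (p + 1) q) S = bag d (f + 1) ∧ (siteAfter (bag (p + 1) q) S).a = p + 1 ∧
      (siteAfter (bag (p + 1) q) S).b = p + q ∧ (siteAfter (bag (p + 1) q) S).c = q := by
  have hS := S.capacity
  obtain ⟨X, Y, Z, a', b', c', hX, hY, hZ, h, h1, h2, h3, h4, h5, h6⟩ :=
    after_finite (p + 1) (p + 1 + q) q S
  replace hX : X = p + 1 + q := by omega
  replace hY : Y = d + q := by omega
  replace hZ : Z = S.b + 1 := by omega
  subst hX hY hZ
  rw [bag, h, bag]
  simp only [Carrier.ext_iff, Nat.cast_inj]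
  refine ⟨⟨?_, ?_, ?_⟩, ?_, ?_, ?_⟩ <;> omega

/-! ### The Yang-Baxter relation -/

/-- The scattering of a bag `(p, p + q, q)`, passing another carrier. -/
def Cross (A L A' L' : Carrier) : Prop :=
  ∃ p q p' q' e f e' f' : ℕ, A = bag p q ∧ A' = bag p' q' ∧
    ((∃ d d' : ℕ, L = ⟨d, e, f⟩ ∧ L' = ⟨d', e', f'⟩ ∧ e ≤ d + f ∧ p' = min e d ∧
      p' + q' = e + min p (min f (d + f - e)) ∧ d' + p' = d + p ∧
      e' + (p' + q') = e + (p + q) ∧ f' + q' = f + q) ∨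
    (L = ⟨⊤, e, f⟩ ∧ L' = ⟨⊤, e', f'⟩ ∧ p' = e ∧ q' = min p f ∧ e' + q' = p + q ∧
      f' + q' = f + q))

theorem site_eq {S S' : Site} (ha : S.a = S'.a) (hc : S.c = S'.c) : S = S' := by
  have h := S.capacity
  have h' := S'.capacity
  ext <;> omega

theorem top_after_empty (e f : ℕ) (S : Site) (hc : S.c = 0) :
    ∃ y f', y = min f (e + 1) ∧ f' + y = f ∧ carrierAfter ⟨⊤, e, f⟩ S = ⟨⊤, S.b, f'⟩ ∧
      (siteAfter ⟨⊤, e, f⟩ S).a + y = e + 1 ∧ (siteAfter ⟨⊤, e, f⟩ S).c = y := by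
  have hS := S.capacity
  obtain ⟨X, Y, Z, e1, f1, hX, hY, hZ, h, hb, hf, sa, sb, sc⟩ := after_top e f S
  replace hX : X = e := by omega
  replace hZ : Z = S.b := by omega
  refine ⟨min f (e + 1), f1, rfl, by omega, ?_, by omega, by omega⟩
  rw [h, show e1 = S.b by omega]

theorem top_after_full (e f t : ℕ) (S : Site) (hc : S.c = t + 1) :
    ∃ y f', y = min f e ∧ f' + y = f + t + 1 ∧ carrierAfter ⟨⊤, e, f⟩ S = ⟨⊤, S.a, f'⟩ ∧
      (siteAfter ⟨⊤, e, f⟩ S).a + y = e + t + 1 ∧ (siteAfter ⟨⊤, e, f⟩ S).c = y := by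
  have hS := S.capacity
  obtain ⟨X, Y, Z, e1, f1, hX, hY, hZ, h, hb, hf, sa, sb, sc⟩ := after_top e f S
  replace hZ : Z = S.b + 1 := by omega
  refine ⟨min f e, f1, rfl, by omega, ?_, by omega, by omega⟩
  rw [h, show e1 = S.a by omega]

theorem finite_after_empty (d e f : ℕ) (S : Site) (hd : e ≤ d + f) (hc : S.c = 0) :
    ∃ y d' f', y = min f (e + 1) ∧ d' + e = d + S.b + y ∧ f' + y = f ∧
      carrierAfter ⟨d, e, f⟩ S = ⟨d', S.b, f'⟩ ∧
      (siteAfter ⟨d, e, f⟩ S).a + y = e + 1 ∧ (siteAfter ⟨d, e, f⟩ S).c = y := by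
  have hS := S.capacity
  obtain ⟨X, Y, Z, d1, e1, f1, hX, hY, hZ, h, ha, hb, hf, sa, sb, sc⟩ := after_finite d e f S
  replace hX : X = e := by omega
  replace hZ : Z = S.b := by omega
  refine ⟨min f (e + 1), d1, f1, rfl, by omega, by omega, ?_, by omega, by omega⟩
  rw [h, show e1 = S.b by omega]

theorem finite_after_full_zero (e f t : ℕ) (S : Site) (hd : e ≤ f) (hc : S.c = t + 1) :
    ∃ f', f' + e = f + t ∧ carrierAfter ⟨(0 : ℕ), e, f⟩ S = ⟨S.a, S.b, f'⟩ ∧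
      (siteAfter ⟨(0 : ℕ), e, f⟩ S).a = 0 ∧ (siteAfter ⟨(0 : ℕ), e, f⟩ S).c = e + 1 := by
  have hS := S.capacity
  obtain ⟨X, Y, Z, d1, e1, f1, hX, hY, hZ, h, ha, hb, hf, sa, sb, sc⟩ := after_finite 0 e f S
  replace hX : X = e := by omega
  replace hY : Y = S.a + e := by omega
  replace hZ : Z = S.b := by omega
  refine ⟨f1, by omega, ?_, by omega, by omega⟩
  rw [h, show d1 = S.a by omega, show e1 = S.b by omega]

theorem finite_after_full (d e f t : ℕ) (S : Site) (hc : S.c = t + 1) :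
    ∃ x y d' e' f', y = min f e ∧ x = min (e + t + 1) (d + 1 + y) ∧ d' + x = d + 1 + S.a + y ∧
      e' + x = e + S.a + t + 1 ∧ f' + y = f + t + 1 ∧
      carrierAfter ⟨(d + 1 : ℕ), e, f⟩ S = ⟨d', e', f'⟩ ∧
      (siteAfter ⟨(d + 1 : ℕ), e, f⟩ S).a + y = x ∧
      (siteAfter ⟨(d + 1 : ℕ), e, f⟩ S).c = y := by
  have hS := S.capacity
  obtain ⟨X, Y, Z, d1, e1, f1, hX, hY, hZ, h, ha, hb, hf, sa, sb, sc⟩ := after_finite (d + 1) e f S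
  replace hZ : Z = S.b + 1 := by omega
  subst hZ
  rcases le_total f e with hfe | hfe
  · replace hY : Y = S.a + f := by omega
    subst hY
    replace hX : X = min (e + t + 1) (d + 1 + f) := by omega
    refine ⟨X, f, d1, e1, f1, (min_eq_left hfe).symm, hX, ?_, ?_, ?_, h, ?_, ?_⟩ <;>
      clear hX <;> omega
  · replace hY : Y = S.a + e := by omega
    subst hY
    replace hX : X = min (e + t + 1) (d + 1 + e) := by omega
    refine ⟨X, e, d1, e1, f1, (min_eq_right hfe).symm, hX, ?_, ?_, ?_, h, ?_, ?_⟩ <;>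
      clear hX <;> omega

/-- The three ways in which a bag passes a site. -/
theorem bag_after (p q : ℕ) (S : Site) :
    ∃ p' q', carrierAfter (bag p q) S = bag p' q' ∧
      ((S.c = 0 ∧ p' = S.b ∧ q' = 0 ∧ (siteAfter (bag p q) S).a = p + 1 ∧
          (siteAfter (bag p q) S).c = q) ∨
        (p = 0 ∧ p' = S.a ∧ q' + 1 = S.c ∧ (siteAfter (bag p q) S).a = 0 ∧
          (siteAfter (bag p q) S).c = q + 1) ∨
        (1 ≤ p ∧ 1 ≤ S.c ∧ p' = S.a ∧ q' = S.c ∧ (siteAfter (bag p q) S).a = p ∧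
          (siteAfter (bag p q) S).c = q)) := by
  rcases hc : S.c with _ | f
  · obtain ⟨h, h1, h2, h3⟩ := bag_after_empty p q S.b S rfl hc
    exact ⟨_, _, h, Or.inl ⟨rfl, rfl, rfl, h1, h3⟩⟩
  · rcases p with _ | p
    · obtain ⟨h, h1, h2, h3⟩ := bag_after_full q S.a f S rfl hc
      exact ⟨_, _, h, Or.inr (Or.inl ⟨rfl, rfl, rfl, h1, h3⟩)⟩
    · obtain ⟨h, h1, h2, h3⟩ := bag_after_swap p q S.a f S rfl hc
      exact ⟨_, _, h, Or.inr (Or.inr ⟨by omega, by omega, rfl, rfl, h1, h3⟩)⟩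

theorem top_after (e f : ℕ) (S : Site) :
    ∃ y e1 f1, carrierAfter ⟨⊤, e, f⟩ S = ⟨⊤, e1, f1⟩ ∧ (siteAfter ⟨⊤, e, f⟩ S).c = y ∧
      f1 + y = f + S.c ∧
      ((S.c = 0 ∧ e1 = S.b ∧ y = min f (e + 1) ∧ (siteAfter ⟨⊤, e, f⟩ S).a + y = e + 1) ∨
        (1 ≤ S.c ∧ e1 = S.a ∧ y = min f e ∧ (siteAfter ⟨⊤, e, f⟩ S).a + y = e + S.c)) := by
  rcases hc : S.c with _ | t
  · obtain ⟨y, f1, hy, hf, h, ha, hc⟩ := top_after_empty e f S hc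
    exact ⟨y, _, f1, h, hc, by omega, Or.inl ⟨rfl, rfl, hy, ha⟩⟩
  · obtain ⟨y, f1, hy, hf, h, ha, hc⟩ := top_after_full e f t S hc
    exact ⟨y, _, f1, h, hc, by omega, Or.inr ⟨by omega, rfl, hy, ha⟩⟩

theorem finite_after (d e f : ℕ) (S : Site) (hd : e ≤ d + f) :
    ∃ d1 e1 f1 : ℕ, carrierAfter ⟨d, e, f⟩ S = ⟨d1, e1, f1⟩ ∧
      f1 + (siteAfter ⟨d, e, f⟩ S).c = f + S.c ∧
      ((S.c = 0 ∧ ∃ y, (siteAfter ⟨d, e, f⟩ S).c = y ∧ e1 = S.b ∧ y = min f (e + 1) ∧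
          d1 + e = d + S.b + y ∧ (siteAfter ⟨d, e, f⟩ S).a + y = e + 1) ∨
        (1 ≤ S.c ∧ d = 0 ∧ d1 = S.a ∧ e1 + 1 = S.a + S.c ∧
          (siteAfter ⟨d, e, f⟩ S).a = 0 ∧ (siteAfter ⟨d, e, f⟩ S).c = e + 1) ∨
        (1 ≤ S.c ∧ 1 ≤ d ∧ ∃ x y, (siteAfter ⟨d, e, f⟩ S).c = y ∧ y = min f e ∧
          x = min (e + S.c) (d + y) ∧ d1 + x = d + S.a + y ∧ e1 + x = e + S.a + S.c ∧
          (siteAfter ⟨d, e, f⟩ S).a + y = x)) := by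
  have hS := S.capacity
  rcases hc : S.c with _ | t
  · obtain ⟨y, d1, f1, hy, h1, h2, h, ha, hc⟩ := finite_after_empty d e f S hd hc
    exact ⟨d1, _, f1, h, by omega, Or.inl ⟨rfl, y, hc, rfl, hy, h1, ha⟩⟩
  · rcases d with _ | d
    · obtain ⟨f1, hf, h, ha, hc'⟩ := finite_after_full_zero e f t S (by omega) hc
      exact ⟨_, _, f1, h, by omega, Or.inr (Or.inl ⟨by omega, rfl, rfl, by omega, ha, hc'⟩)⟩
    · obtain ⟨x, y, d1, e1, f1, hy, hx, h1, h2, h3, h, ha, hc⟩ := finite_after_full d e f t S hc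
      exact ⟨d1, e1, f1, h, by omega,
        Or.inr (Or.inr ⟨by omega, by omega, x, y, hc, hy, hx, h1, h2, ha⟩)⟩

/-- The formulas are the limit of the finite ones as d tends to infinity. -/
theorem cross_top (p q e f e' f' p' q' : ℕ) (S : Site) (hp : p' = e) (hq : q' = min p f)
    (he : e' + q' = p + q) (hf : f' + q' = f + q) :
    Cross (carrierAfter (bag p q) (siteAfter ⟨⊤, e, f⟩ S)) (carrierAfter ⟨⊤, e, f⟩ S)
      (carrierAfter (bag p' q') S) (carrierAfter ⟨⊤, e', f'⟩ (siteAfter (bag p' q') S)) ∧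
    siteAfter (bag p q) (siteAfter ⟨⊤, e, f⟩ S) =
      siteAfter ⟨⊤, e', f'⟩ (siteAfter (bag p' q') S) := by
  obtain ⟨y, e1, f1, h, hc, hf1, ls⟩ := top_after e f S
  obtain ⟨p2, q2, g, gs⟩ := bag_after p q (siteAfter ⟨⊤, e, f⟩ S)
  obtain ⟨p3, q3, k, ks⟩ := bag_after p' q' S
  obtain ⟨y', e4, f4, h', hc', hf1', ls'⟩ := top_after e' f' (siteAfter (bag p' q') S)
  rw [h, g, k, h']
  generalize siteAfter (bag p' q') S = S3 at *
  generalize siteAfter ⟨⊤, e', f'⟩ S3 = S4 at *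
  generalize siteAfter ⟨⊤, e, f⟩ S = S1 at *
  generalize siteAfter (bag p q) S1 = S2 at *
  clear h g k h'
  -- Only natural numbers remain: each of the four passages is piecewise linear, and every
  -- consistent choice of pieces is settled by arithmetic.
  have key : p3 = e1 ∧ q3 = min p2 f1 ∧ e4 + q3 = p2 + q2 ∧ f4 + q3 = f1 + q2 ∧
      S2.a = S4.a ∧ S2.c = S4.c := by
    have c0 := S.capacity
    have c1 := S1.capacity
    have c3 := S3.capacity
    revert ls'; revert ks; revert gs; revert ls
    rintro (ls | ls) (gs | gs | gs) <;> rintro (ks | ks | ks) <;> (try (exfalso; lia)) <;>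
    rintro (ls' | ls') <;> (try (exfalso; lia)) <;>
    (refine ⟨?_, ?_, ?_, ?_, ?_, ?_⟩ <;> lia)
  obtain ⟨k1, k2, k3, k4, k5, k6⟩ := key
  exact ⟨⟨p2, q2, p3, q3, e1, f1, e4, f4, rfl, rfl, Or.inr ⟨rfl, rfl, k1, k2, k3, k4⟩⟩,
    site_eq k5 k6⟩

-- `hp` and `hq` define the scattering, and the other three equations conserve room, baskets and
-- balls. The number d + f - e is the level of the carrier, so `hd` says that the level is not
-- negative.
set_option maxHeartbeats 1000000 in
theorem cross_finite (p q d e f d' e' f' p' q' : ℕ) (S : Site) (hd : e ≤ d + f)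
    (hp : p' = min e d) (hq : p' + q' = e + min p (min f (d + f - e))) (hd' : d' + p' = d + p)
    (he : e' + (p' + q') = e + (p + q)) (hf : f' + q' = f + q) :
    Cross (carrierAfter (bag p q) (siteAfter ⟨d, e, f⟩ S)) (carrierAfter ⟨d, e, f⟩ S)
      (carrierAfter (bag p' q') S) (carrierAfter ⟨d', e', f'⟩ (siteAfter (bag p' q') S)) ∧
    siteAfter (bag p q) (siteAfter ⟨d, e, f⟩ S) =
      siteAfter ⟨d', e', f'⟩ (siteAfter (bag p' q') S) := by
  obtain ⟨d1, e1, f1, h, hf1, ls⟩ := finite_after d e f S hd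
  obtain ⟨p2, q2, g, gs⟩ := bag_after p q (siteAfter ⟨d, e, f⟩ S)
  obtain ⟨p3, q3, k, ks⟩ := bag_after p' q' S
  obtain ⟨d4, e4, f4, h', hf1', ls'⟩ := finite_after d' e' f' (siteAfter (bag p' q') S) (by lia)
  rw [h, g, k, h']
  generalize siteAfter (bag p' q') S = S3 at *
  generalize siteAfter ⟨d', e', f'⟩ S3 = S4 at *
  generalize siteAfter ⟨d, e, f⟩ S = S1 at *
  generalize siteAfter (bag p q) S1 = S2 at *
  clear h g k h'
  have key : e1 ≤ d1 + f1 ∧ p3 = min e1 d1 ∧ p3 + q3 = e1 + min p2 (min f1 (d1 + f1 - e1)) ∧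
      d4 + p3 = d1 + p2 ∧ e4 + (p3 + q3) = e1 + (p2 + q2) ∧ f4 + q3 = f1 + q2 ∧
      S2.a = S4.a ∧ S2.c = S4.c := by
    have c0 := S.capacity
    have c1 := S1.capacity
    have c3 := S3.capacity
    -- The level l does not change at a site; naming it removes the truncated subtraction on both
    -- sides.
    obtain ⟨l, hl⟩ : ∃ l, d + f = e + l := ⟨d + f - e, by lia⟩
    have hl1 : d1 + f1 = e1 + l := by
      clear gs ks ls' hp hq
      rcases ls with ⟨l1, y, l2, l3, l4, l5, l6⟩ | ⟨l1, l2, l3, l4, l5, l6⟩ |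
        ⟨l1, l2, x, y, l3, l4, l5, l6, l7, l8⟩
      · lia
      · lia
      · clear l4 l5
        lia
    rw [show d1 + f1 - e1 = l by lia]
    rw [show d + f - e = l by lia] at hq
    clear hd
    revert ls'; revert ks; revert gs; revert ls
    rintro (⟨l1, y, l2, l3, l4, l5, l6⟩ | ⟨l1, l2, l3, l4, l5, l6⟩ |
      ⟨l1, l2, x, y, l3, l4, l5, l6, l7, l8⟩)
    all_goals rintro (gs | gs | gs)
    all_goals try (exfalso; lia)
    all_goals rintro (ks | ks | ks)
    all_goals try (exfalso; lia)
    all_goals rintro (⟨m1, y', m2, m3, m4, m5, m6⟩ | ⟨m1, m2, m3, m4, m5, m6⟩ |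
      ⟨m1, m2, x', y', m3, m4, m5, m6, m7, m8⟩)
    all_goals try (exfalso; lia)
    all_goals refine ⟨?_, ?_, ?_, ?_, ?_, ?_, ?_, ?_⟩ <;> lia
  obtain ⟨k0, k1, k2, k3, k4, k5, k6, k7⟩ := key
  exact ⟨⟨p2, q2, p3, q3, e1, f1, e4, f4, rfl, rfl,
    Or.inl ⟨d1, d4, rfl, rfl, k0, k1, k2, k3, k4, k5⟩⟩,
    site_eq k6 k7⟩

/-- The Yang-Baxter relation: the order in which a bag and another carrier pass a site is
immaterial, up to their scattering. -/
theorem Cross.after {A L A' L' : Carrier} (h : Cross A L A' L') (S : Site) :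
    Cross (carrierAfter A (siteAfter L S)) (carrierAfter L S) (carrierAfter A' S)
      (carrierAfter L' (siteAfter A' S)) ∧
    siteAfter A (siteAfter L S) = siteAfter L' (siteAfter A' S) := by
  obtain ⟨p, q, p', q', e, f, e', f', rfl, rfl, h⟩ := h
  rcases h with ⟨d, d', rfl, rfl, h0, h1, h2, h3, h4, h5⟩ | ⟨rfl, rfl, h1, h2, h3, h4⟩
  · exact cross_finite p q d e f d' e' f' p' q' S h0 h1 h2 h3 h4 h5
  · exact cross_top p q e f e' f' p' q' S h1 h2 h3 h4

theorem cross_u (ℓ : ℕ∞) : Cross (u 0) (u ℓ) (u 0) (u ℓ) := by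
  rw [u_zero]
  refine ⟨0, 0, 0, 0, 0, 0, 0, 0, rfl, rfl, ?_⟩
  induction ℓ with
  | top => exact Or.inr ⟨rfl, rfl, rfl, by simp, by simp, by simp⟩
  | coe l => exact Or.inl ⟨l, l, rfl, rfl, by simp, by simp, by simp, by simp, by simp, by simp⟩

/-! ### Carriers on the whole line and commuting evolutions -/

theorem carrierAt_succ (ℓ : ℕ∞) (S : State) (i : ℤ) :
    carrierAt ℓ S (i + 1) = carrierAfter (carrierAt ℓ S i) (S.site i) := by
  unfold carrierAt
  rcases lt_or_ge i S.vacuum_left.choose with h | h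
  · rw [show (i + 1 - S.vacuum_left.choose).toNat = 0 by omega,
      show (i - S.vacuum_left.choose).toNat = 0 by omega, S.vacuum_left.choose_spec i h]
    exact (u_V ℓ).2.symm
  · rw [show (i + 1 - S.vacuum_left.choose).toNat = (i - S.vacuum_left.choose).toNat + 1 by omega,
      carrierFrom]
    congr 2
    omega

/-- A sequence of carriers that starts in the vacuum is the one of the time evolution. -/
theorem carrierAt_unique (ℓ : ℕ∞) (S : State) (κ : ℤ → Carrier) (n : ℤ)
    (hl : ∀ i ≤ n, κ i = u ℓ) (hs : ∀ i, κ (i + 1) = carrierAfter (κ i) (S.site i)) (i : ℤ) :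
    carrierAt ℓ S i = κ i := by
  have hc : ∀ i ≤ S.vacuum_left.choose, carrierAt ℓ S i = u ℓ := fun i hi => by
    rw [carrierAt, show (i - S.vacuum_left.choose).toNat = 0 by omega, carrierFrom]
  rcases le_total i (min n S.vacuum_left.choose) with h | h
  · rw [hl i (by omega), hc i (by omega)]
  · induction i, h using Int.leInduction with
    | base => rw [hl _ (by omega), hc _ (by omega)]
    | succ i h ih => rw [hs, carrierAt_succ, ih]

theorem carrierAt_of_vacuum (ℓ : ℕ∞) (S : State) (n : ℤ) (h : ∀ i < n, S.site i = V) :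
    ∀ i ≤ n, carrierAt ℓ S i = u ℓ := by
  have hc : ∀ k : ℕ, S.vacuum_left.choose + k ≤ n →
      carrierAt ℓ S (S.vacuum_left.choose + k) = u ℓ := by
    intro k
    induction k with
    | zero => intro; simp [carrierAt, carrierFrom]
    | succ k ih =>
      intro hk
      rw [show S.vacuum_left.choose + ((k + 1 : ℕ) : ℤ) = S.vacuum_left.choose + k + 1 by
        push_cast; ring, carrierAt_succ, ih (by omega), h _ (by omega)]
      exact (u_V ℓ).2
  intro i hi
  rcases le_total i S.vacuum_left.choose with hn | hn
  · rw [carrierAt, show (i - S.vacuum_left.choose).toNat = 0 by omega, carrierFrom]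
  · obtain ⟨k, hk⟩ := Int.eq_ofNat_of_zero_le (sub_nonneg.2 hn)
    rw [show i = S.vacuum_left.choose + k by omega]
    exact hc k (by omega)

/-- Frees the evolution from the arbitrarily chosen starting site in `carrierAt`. -/
theorem T_eq (ℓ : ℕ∞) (S S' : State) (κ : ℤ → Carrier) (n : ℤ)
    (hl : ∀ i ≤ n, κ i = u ℓ) (hs : ∀ i, κ (i + 1) = carrierAfter (κ i) (S.site i))
    (h : ∀ i, S'.site i = siteAfter (κ i) (S.site i)) : T ℓ S = S' := by
  ext i : 2
  rw [h i, ← carrierAt_unique ℓ S κ n hl hs i]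
  rfl

/-- The time evolutions `T_ℓ` commute with `T_0`. -/
theorem T_comm (ℓ : ℕ∞) (S : State) : T 0 (T ℓ S) = T ℓ (T 0 S) := by
  -- At each site the carriers of the two orders are related by scattering; far to the left they are
  -- all in their initial states.
  have key : ∀ i, Cross (carrierAt 0 (T ℓ S) i) (carrierAt ℓ S i) (carrierAt 0 S i)
      (carrierAt ℓ (T 0 S) i) := by
    have hl : ∀ (ℓ : ℕ∞) (S : State), ∃ n, ∀ i ≤ n, carrierAt ℓ S i = u ℓ := fun ℓ S =>
      ⟨_, fun i hi => carrierAt_of_vacuum ℓ S _ S.vacuum_left.choose_spec i hi⟩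
    obtain ⟨n1, h1⟩ := hl 0 (T ℓ S)
    obtain ⟨n2, h2⟩ := hl ℓ S
    obtain ⟨n3, h3⟩ := hl 0 S
    obtain ⟨n4, h4⟩ := hl ℓ (T 0 S)
    have hb : ∀ i ≤ min (min n1 n2) (min n3 n4), Cross (carrierAt 0 (T ℓ S) i)
        (carrierAt ℓ S i) (carrierAt 0 S i) (carrierAt ℓ (T 0 S) i) := fun i hi => by
      rw [h1 i (by omega), h2 i (by omega), h3 i (by omega), h4 i (by omega)]
      exact cross_u ℓ
    intro i
    rcases le_total i (min (min n1 n2) (min n3 n4)) with h | h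
    · exact hb i h
    · induction i, h using Int.leInduction with
      | base => exact hb _ le_rfl
      | succ i h ih =>
        rw [carrierAt_succ, carrierAt_succ, carrierAt_succ, carrierAt_succ]
        exact (ih.after (S.site i)).1
  ext i : 2
  exact ((key i).after (S.site i)).2

/-! ### Evolution of finite words -/

/-- A carrier `C` passes the sites of the word `w`: they become the word `w'`, and it becomes
`C'`. -/
inductive Run : Carrier → List Site → List Site → Carrier → Prop
  | nil (C : Carrier) : Run C [] [] C
  | cons {C : Carrier} {S S' : Site} {C' C'' : Carrier} {w w' : List Site}
      (hS : siteAfter C S = S') (hC : carrierAfter C S = C') (h : Run C' w w' C'') :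
      Run C (S :: w) (S' :: w') C''

theorem Run.append {C C' C'' : Carrier} {w w' z z' : List Site} (h : Run C w w' C')
    (h' : Run C' z z' C'') : Run C (w ++ z) (w' ++ z') C'' := by
  induction h with
  | nil => exact h'
  | cons hS hC _ ih => exact Run.cons hS hC (ih h')

theorem Run.length_eq {C C' : Carrier} {w w' : List Site} (h : Run C w w' C') :
    w'.length = w.length := by
  induction h with
  | nil => rfl
  | cons _ _ _ ih => simp [ih]

theorem Run.exists_carriers {C C' : Carrier} {w w' : List Site} (h : Run C w w' C') :
    ∃ κ : ℕ → Carrier, κ 0 = C ∧ κ w.length = C' ∧ ∀ j < w.length,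
      κ (j + 1) = carrierAfter (κ j) (w.getD j V) ∧
        w'.getD j V = siteAfter (κ j) (w.getD j V) := by
  induction h with
  | nil C => exact ⟨fun _ => C, rfl, rfl, by simp⟩
  | @cons C S S' C' C'' w w' hS hC h ih =>
    obtain ⟨κ, h0, h1, h2⟩ := ih
    refine ⟨fun j => Nat.casesOn j C κ, rfl, h1, ?_⟩
    rintro (_ | j) hj
    · simp [h0, hS, hC]
    · simpa using h2 j (by simpa using hj)

theorem place_site (w : List Site) (x i : ℤ) :
    (place w x).site i = if x ≤ i then w.getD (i - x).toNat V else V := rfl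

/-- Since the run begins and ends with `u ℓ`, which the vacuum leaves unchanged, its carriers extend
constantly to both sides. -/
theorem T_place {ℓ : ℕ∞} {w w' : List Site} (h : Run (u ℓ) w w' (u ℓ)) (x : ℤ) :
    T ℓ (place w x) = place w' x := by
  obtain ⟨κ, h0, h1, h2⟩ := h.exists_carriers
  have hlen := h.length_eq
  have hV : ∀ (w : List Site) (i : ℤ), i < x ∨ x + w.length ≤ i → (place w x).site i = V := by
    rintro w i (hi | hi)
    · exact if_neg (by omega)
    · rw [place_site, if_pos (by omega), List.getD_eq_default _ _ (by omega)]
  have hw : ∀ (w : List Site) (j : ℕ), (place w x).site (x + j) = w.getD j V := fun w j => by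
    rw [place_site, if_pos (by omega)]
    congr
    omega
  have hout : ∀ i : ℤ, (i < x ∨ x + w.length ≤ i) ∨ ∃ j : ℕ, j < w.length ∧ i = x + j := by
    intro i
    by_cases hi : i < x ∨ x + w.length ≤ i
    · exact Or.inl hi
    · exact Or.inr ⟨(i - x).toNat, by omega, by omega⟩
  let f : ℤ → Carrier := fun i =>
    if x ≤ i ∧ i ≤ x + w.length then κ (i - x).toNat else u ℓ
  have hf : ∀ i : ℤ, i ≤ x ∨ x + w.length ≤ i → f i = u ℓ := by
    intro i hi
    simp only [f]
    split
    · rcases hi with hi | hi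
      · rw [show (i - x).toNat = 0 by omega, h0]
      · rw [show (i - x).toNat = w.length by omega, h1]
    · rfl
  have hfj : ∀ j : ℕ, j ≤ w.length → f (x + j) = κ j := by
    intro j hj
    simp only [f]
    rw [if_pos (by omega)]
    congr
    omega
  refine T_eq ℓ _ _ f x (fun i hi => hf i (Or.inl hi)) (fun i => ?_) (fun i => ?_)
  · rcases hout i with hi | ⟨j, hj, rfl⟩
    · rw [hV w i hi, hf i (by omega), hf (i + 1) (by omega)]
      exact (u_V ℓ).2.symm
    · have := hfj (j + 1) (by omega)
      push_cast at this
      rw [hw, add_assoc, this, hfj j hj.le, (h2 j hj).1]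
  · rcases hout i with hi | ⟨j, hj, rfl⟩
    · rw [hV w i hi, hV w' i (by omega), hf i (by omega)]
      exact (u_V ℓ).1.symm
    · rw [hw, hw, hfj j hj.le, (h2 j hj).2]

theorem place_vacuum_append (g : ℕ) (w : List Site) (x : ℤ) :
    place (List.replicate g V ++ w) x = place w (x + g) := by
  ext i : 2
  simp only [place]
  by_cases h : x + g ≤ i
  · rw [if_pos (by omega), if_pos h, List.getD_append_right _ _ _ _ (by simp; omega)]
    congr 1
    simp
    omega
  · rw [if_neg h]
    split
    · rw [List.getD_append _ _ _ _ (by simp; omega)]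
      simp
    · rfl

theorem place_append_vacuum (g : ℕ) (w : List Site) (x : ℤ) :
    place (w ++ List.replicate g V) x = place w x := by
  ext i : 2
  simp only [place]
  split
  · rcases lt_or_ge (i - x).toNat w.length with h | h
    · rw [List.getD_append _ _ _ _ h]
    · rw [List.getD_append_right _ _ _ _ h, List.getD_eq_default w _ h]
      simp
  · rfl

/-! ### Free propagation of the two solitons -/

/-- Without balls, carrier and site merely exchange baskets, so a basket word is delayed by one site
at every level. -/
theorem basket_step (ℓ : ℕ∞) (k j : ℕ) :
    siteAfter ⟨ℓ + k, k, 0⟩ (B j) = B k ∧ carrierAfter ⟨ℓ + k, k, 0⟩ (B j) = ⟨ℓ + j, j, 0⟩ := by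
  induction ℓ with
  | top =>
    simp only [top_add]
    simp only [siteAfter, carrierAfter, minX_of_top, minZ_of_top, minY, B, Site.ext_iff,
      Carrier.ext_iff]
    simp
    omega
  | coe n =>
    simp only [← Nat.cast_add]
    simp only [siteAfter, carrierAfter, minX_of_finite, minZ_of_finite, minY, B, Site.ext_iff,
      Carrier.ext_iff]
    norm_cast
    omega

theorem fast_load (r : ℕ∞) (c : ℕ) :
    siteAfter ⟨r + 1, 0, c⟩ F = V ∧ carrierAfter ⟨r + 1, 0, c⟩ F = ⟨r, 0, c + 1⟩ := by
  induction r with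
  | top =>
    simp only [top_add]
    simp only [siteAfter, carrierAfter, minX_of_top, minZ_of_top, minY, F, V, Site.ext_iff,
      Carrier.ext_iff]
    simp
  | coe n =>
    rw [show (n : ℕ∞) + 1 = ((n + 1 : ℕ) : ℕ∞) by simp]
    simp only [siteAfter, carrierAfter, minX_of_finite, minZ_of_finite, minY, F, V, Site.ext_iff,
      Carrier.ext_iff]
    norm_cast
    omega

theorem fast_full (c : ℕ) :
    siteAfter ⟨0, 0, c⟩ F = F ∧ carrierAfter ⟨0, 0, c⟩ F = ⟨0, 0, c⟩ := by
  rw [show (0 : ℕ∞) = ((0 : ℕ) : ℕ∞) by simp]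
  simp only [siteAfter, carrierAfter, minX_of_finite, minZ_of_finite, minY, F, Site.ext_iff,
      Carrier.ext_iff]
  norm_cast
  omega

theorem fast_unload (r : ℕ∞) (c : ℕ) :
    siteAfter ⟨r, 0, c + 1⟩ V = F ∧ carrierAfter ⟨r, 0, c + 1⟩ V = ⟨r + 1, 0, c⟩ := by
  induction r with
  | top =>
    simp only [siteAfter, carrierAfter, minX_of_top, minZ_of_top, minY, F, V, Site.ext_iff,
      Carrier.ext_iff]
    simp
  | coe n =>
    simp only [siteAfter, carrierAfter, minX_of_finite, minZ_of_finite, minY, F, V, Site.ext_iff,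
      Carrier.ext_iff]
    norm_cast
    omega

theorem run_vacuum (ℓ : ℕ∞) (g : ℕ) :
    Run (u ℓ) (List.replicate g V) (List.replicate g V) (u ℓ) := by
  induction g with
  | zero => exact Run.nil _
  | succ g ih => exact Run.cons (u_V ℓ).1 (u_V ℓ).2 ih

theorem run_baskets (ℓ : ℕ∞) (k : ℕ) (as : List ℕ) :
    Run ⟨ℓ + k, k, 0⟩ (basketSoliton as ++ [V]) (B k :: basketSoliton as) (u ℓ) := by
  induction as generalizing k with
  | nil =>
    have h := basket_step ℓ k 0
    refine Run.cons h.1 h.2 ?_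
    simpa [u, basketSoliton] using Run.nil (u ℓ)
  | cons a as ih => exact Run.cons (basket_step ℓ k a).1 (basket_step ℓ k a).2 (ih a)

theorem run_basketSoliton (ℓ : ℕ∞) (as : List ℕ) :
    Run (u ℓ) (basketSoliton as ++ [V]) ([V] ++ basketSoliton as) (u ℓ) := by
  have := run_baskets ℓ 0 as
  rwa [Nat.cast_zero, add_zero] at this

theorem run_load (r : ℕ∞) (c k : ℕ) :
    Run ⟨r + k, 0, c⟩ (List.replicate k F) (List.replicate k V) ⟨r, 0, c + k⟩ := by
  induction k generalizing c with
  | zero => simpa using Run.nil _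
  | succ k ih =>
    have h := fast_load (r + k) c
    rw [Nat.cast_succ, ← add_assoc]
    refine Run.cons h.1 h.2 ?_
    rw [show c + (k + 1) = c + 1 + k by ring]
    exact ih _

theorem run_unload (r : ℕ∞) (c k : ℕ) :
    Run ⟨r, 0, c + k⟩ (List.replicate k V) (List.replicate k F) ⟨r + k, 0, c⟩ := by
  induction k generalizing r with
  | zero => simpa using Run.nil _
  | succ k ih =>
    have h := fast_unload r (c + k)
    refine Run.cons h.1 h.2 ?_
    rw [show r + ((k + 1 : ℕ) : ℕ∞) = r + 1 + k by push_cast; ring]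
    exact ih _

theorem run_full (c k : ℕ) :
    Run ⟨0, 0, c⟩ (List.replicate k F) (List.replicate k F) ⟨0, 0, c⟩ := by
  induction k with
  | zero => exact Run.nil _
  | succ k ih => exact Run.cons (fast_full c).1 (fast_full c).2 ih

/-- `v = min(ℓ, m)`. -/
theorem run_fastSoliton (ℓ : ℕ∞) (m v : ℕ) (hv : (v : ℕ∞) = min ℓ m) :
    Run (u ℓ) (fastSoliton m ++ List.replicate v V) (List.replicate v V ++ fastSoliton m)
      (u ℓ) := by
  have hm : v ≤ m := by
    have : (v : ℕ∞) ≤ m := hv.trans_le (min_le_right _ _)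
    exact_mod_cast this
  obtain ⟨r, hr⟩ := exists_add_of_le (hv.trans_le (min_le_left _ _))
  obtain ⟨d, rfl⟩ := Nat.exists_eq_add_of_le hm
  have h1 : Run (u ℓ) (List.replicate v F) (List.replicate v V) ⟨r, 0, v⟩ := by
    have := run_load r 0 v
    rwa [add_comm r, ← hr, zero_add] at this
  have h2 : Run ⟨r, 0, v⟩ (List.replicate d F) (List.replicate d F) ⟨r, 0, v⟩ := by
    -- Either the carrier is full after v letters and leaves the rest alone, or there are no further
    -- letters.
    rcases le_total ℓ (v + d : ℕ) with h | h
    · rw [min_eq_left h] at hv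
      have : r = 0 := by
        have hh : (v : ℕ∞) + r = v + 0 := by rw [← hr, hv, add_zero]
        exact WithTop.add_left_cancel (ENat.natCast_ne_top v) hh
      rw [this]
      exact run_full v d
    · rw [min_eq_right h] at hv
      have : d = 0 := by
        have : v = v + d := by exact_mod_cast hv
        omega
      subst this
      exact Run.nil _
  have h3 : Run ⟨r, 0, v⟩ (List.replicate v V) (List.replicate v F) (u ℓ) := by
    have := run_unload r 0 v
    rwa [add_comm r, ← hr, zero_add] at this
  have := (h1.append h2).append h3
  rw [fastSoliton]
  rw [← List.replicate_add] at this
  convert this using 1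
  rw [List.append_assoc, ← List.replicate_add, add_comm d v]

theorem T_fastSoliton {ℓ : ℕ∞} {m v : ℕ} (hv : (v : ℕ∞) = min ℓ m) (x : ℤ) :
    T ℓ (place (fastSoliton m) x) = place (fastSoliton m) (x + v) := by
  have := T_place (run_fastSoliton ℓ m v hv) x
  rwa [place_append_vacuum, place_vacuum_append] at this

theorem T_basketSoliton (ℓ : ℕ∞) (as : List ℕ) (x : ℤ) :
    T ℓ (place (basketSoliton as) x) = place (basketSoliton as) (x + 1) := by
  have := T_place (run_basketSoliton ℓ as) x
  have h := place_append_vacuum 1 (basketSoliton as) x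
  have h' := place_vacuum_append 1 (basketSoliton as) x
  simp only [List.replicate_one] at h h'
  rw [h, h'] at this
  simpa using this

/-- One vacuum site suffices for the carrier to unload its baskets, so it meets the balls as `u ℓ`
again and nothing interacts. -/
theorem T_basket_fast {ℓ : ℕ∞} {m v : ℕ} (hv : (v : ℕ∞) = min ℓ m) (as : List ℕ) (g : ℕ) (x : ℤ) :
    T ℓ (place (separated (basketSoliton as) (g + 1) (fastSoliton m)) x) =
      place (separated (basketSoliton as) (g + v) (fastSoliton m)) (x + 1) := by
  have := T_place (((run_basketSoliton ℓ as).append (run_vacuum ℓ g)).append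
    (run_fastSoliton ℓ m v hv)) x
  have h : basketSoliton as ++ [V] ++ List.replicate g V ++
      (fastSoliton m ++ List.replicate v V) =
      separated (basketSoliton as) (1 + g) (fastSoliton m) ++ List.replicate v V := by
    simp only [separated, List.replicate_add, List.append_assoc, List.replicate_one]
  have h' : [V] ++ basketSoliton as ++ List.replicate g V ++
      (List.replicate v V ++ fastSoliton m) =
      List.replicate 1 V ++ separated (basketSoliton as) (g + v) (fastSoliton m) := by
    simp only [separated, List.replicate_add, List.append_assoc, List.replicate_one]
  rwa [h, h', place_append_vacuum, place_vacuum_append, add_comm 1 g, Nat.cast_one] at this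

/-! ### Sites passed by a list of bags -/

/-- A site `S` is passed by the bags of the list `w`, one after the other: they become the list
`w'`, and it becomes `S'`. -/
inductive Pass : Site → List Carrier → List Carrier → Site → Prop
  | nil (S : Site) : Pass S [] [] S
  | cons {C C' : Carrier} {S S' S'' : Site} {w w' : List Carrier}
      (hC : carrierAfter C S = C') (hS : siteAfter C S = S') (h : Pass S' w w' S'') :
      Pass S (C :: w) (C' :: w') S''

/-- Empty bags with the given numbers of baskets. -/
def baskets (L : List ℕ) : List Carrier := L.map (bag · 0)

/-- The bags with numbers of baskets `L`, followed by an empty slot. All baskets together form a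
row, in which the first `s` baskets are empty, the next `n` are filled, and the others are empty
again. These last are one slot late. -/
def windowed : List ℕ → ℕ → ℕ → List Carrier
  | [], _, _ => [bag 0 0]
  | k :: L, s, n =>
    if k ≤ s then bag k 0 :: windowed L (s - k) n
    else if s + n < k then bag s n :: bag (k - s - n) 0 :: baskets L
    else bag s (k - s) :: windowed L 0 (n - (k - s))

theorem windowed_before (k j n : ℕ) (L : List ℕ) :
    windowed (k :: L) (k + j) n = bag k 0 :: windowed L j n := by
  rw [windowed, if_pos (by omega), Nat.add_sub_cancel_left]

theorem windowed_across (s d e : ℕ) (L : List ℕ) :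
    windowed ((s + d) :: L) s (d + e) = bag s d :: windowed L 0 e := by
  rw [windowed]
  split
  · obtain rfl : d = 0 := by omega
    simp
  · rw [if_neg (by omega), Nat.add_sub_cancel_left, Nat.add_sub_cancel_left]

theorem windowed_zero (L : List ℕ) (hL : ∀ k ∈ L, 1 ≤ k) :
    windowed L 0 0 = bag 0 0 :: baskets L := by
  cases L with
  | nil => rfl
  | cons k L =>
    have := hL k (by simp)
    rw [windowed, if_neg (by omega), if_pos (by omega)]
    rfl

theorem windowed_inside (s n j : ℕ) (L : List ℕ) (hL : ∀ k ∈ L, 1 ≤ k) :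
    windowed ((s + n + j) :: L) s n = bag s n :: bag j 0 :: baskets L := by
  rcases Nat.eq_zero_or_pos j with rfl | hj
  · rw [add_zero, ← windowed_zero L hL]
    exact windowed_across s n 0 L
  · rw [windowed, if_neg (by omega), if_pos (by omega), show s + n + j - s - n = j by omega]

/-- Compared with `windowed_zero`, the empty slot has moved from the front to the back: the row is
one time step early, which is the displacement of the basket soliton by one site. -/
theorem windowed_sum (L : List ℕ) (n : ℕ) : windowed L L.sum n = baskets L ++ [bag 0 0] := by
  induction L with
  | nil => rfl
  | cons k L ih =>
    rw [windowed, if_pos (by simp), List.sum_cons, Nat.add_sub_cancel_left, ih]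
    rfl

theorem pass_baskets (k : ℕ) (L : List ℕ) :
    Pass (B k) (baskets L ++ [bag 0 0]) (bag k 0 :: baskets L) V := by
  induction L generalizing k with
  | nil =>
    obtain ⟨h, ha, hb, hc⟩ := bag_after_empty 0 0 k (B k) rfl rfl
    exact Pass.cons h (site_eq ha hc) (Pass.nil _)
  | cons j L ih =>
    obtain ⟨h, ha, hb, hc⟩ := bag_after_empty j 0 k (B k) rfl rfl
    exact Pass.cons h (site_eq ha hc) (ih j)

/-- The ball in the box waits while full bags pass and leaves with the first empty basket. If all
baskets are full, it stays. -/
theorem pass_full (L : List ℕ) (hL : ∀ k ∈ L, 1 ≤ k) (n x z : ℕ) (S : Site) (ha : S.a = x)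
    (hc : S.c = z + 1) :
    Pass S (windowed L 0 n ++ [bag 0 0]) (bag x z :: windowed L 0 (n + 1))
      (if n < L.sum then V else F) := by
  induction L generalizing n x z S with
  | nil =>
    obtain ⟨h, ha', hb', hc'⟩ := bag_after_full 0 x z S ha hc
    obtain ⟨g, ga, gb, gc⟩ := bag_after_full 0 0 0 F rfl rfl
    exact Pass.cons h (site_eq ha' hc') (Pass.cons g (site_eq ga gc) (Pass.nil _))
  | cons k L ih =>
    have hL' : ∀ k ∈ L, 1 ≤ k := fun j hj => hL j (by simp [hj])
    rw [List.sum_cons]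
    rcases lt_or_ge n k with hn | hn
    · obtain ⟨j, rfl⟩ := Nat.exists_eq_add_of_le (Nat.succ_le_of_lt hn)
      obtain ⟨h, ha', hb', hc'⟩ := bag_after_full n x z S ha hc
      obtain ⟨g, ga, gb, gc⟩ := bag_after_swap j 0 0 n _ ha' hc'
      have h1 := windowed_inside 0 n (j + 1) L hL'
      have h2 := windowed_inside 0 (n + 1) j L hL'
      rw [show 0 + n + (j + 1) = n.succ + j by omega] at h1
      rw [show 0 + (n + 1) + j = n.succ + j by omega] at h2
      rw [if_pos (by omega), h1, h2]
      exact Pass.cons h rfl (Pass.cons g (site_eq ga gc) (pass_baskets j L))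
    · obtain ⟨j, rfl⟩ := Nat.exists_eq_add_of_le hn
      obtain ⟨h, ha', hb', hc'⟩ := bag_after_full k x z S ha hc
      have h1 := windowed_across 0 k j L
      have h2 := windowed_across 0 k (j + 1) L
      rw [zero_add] at h1 h2
      rw [h1, add_assoc, h2]
      simp only [Nat.add_lt_add_iff_left]
      exact Pass.cons h rfl (ih hL' j 0 k _ ha' hc')

/-- The first bag with balls leaves its baskets on the site, and one ball falls into the box, which
frees the first basket of the window. The first empty basket behind the window takes this ball; if
there is none, the ball remains and the window shrinks. -/
theorem pass_windowed (L : List ℕ) (hL : ∀ k ∈ L, 1 ≤ k) (n s i : ℕ) (hn : 1 ≤ n) :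
    Pass (B i) (windowed L s n ++ [bag 0 0]) (bag i 0 :: windowed L (s + 1) n)
      (if L.sum ≤ s + n ∧ s < L.sum then F else V) := by
  induction L generalizing s i with
  | nil => simpa [baskets, windowed] using pass_baskets i [0]
  | cons k L ih =>
    have hL' : ∀ k ∈ L, 1 ≤ k := fun j hj => hL j (by simp [hj])
    rw [List.sum_cons]
    rcases le_or_gt k s with hs | hs
    · obtain ⟨j, rfl⟩ := Nat.exists_eq_add_of_le hs
      obtain ⟨h, ha, hb, hc⟩ := bag_after_empty k 0 i (B i) rfl rfl
      rw [windowed_before, add_assoc, windowed_before]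
      simp only [Nat.add_assoc, Nat.add_le_add_iff_left, Nat.add_lt_add_iff_left]
      exact Pass.cons h (site_eq ha hc) (ih hL' j k)
    · obtain ⟨n, rfl⟩ := Nat.exists_eq_add_of_le' hn
      rcases lt_or_ge (s + (n + 1)) k with hsn | hsn
      · obtain ⟨j, rfl⟩ := Nat.exists_eq_add_of_le (Nat.succ_le_of_lt hsn)
        obtain ⟨h, ha, hb, hc⟩ := bag_after_empty s (n + 1) i (B i) rfl rfl
        obtain ⟨g, ga, gb, gc⟩ := bag_after_swap j 0 (s + 1) n _ ha hc
        have h1 := windowed_inside s (n + 1) (j + 1) L hL'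
        have h2 := windowed_inside (s + 1) (n + 1) j L hL'
        rw [show s + (n + 1) + (j + 1) = (s + (n + 1)).succ + j by omega] at h1
        rw [show s + 1 + (n + 1) + j = (s + (n + 1)).succ + j by omega] at h2
        rw [if_neg (by omega), h1, h2]
        exact Pass.cons h rfl (Pass.cons g (site_eq ga gc) (pass_baskets j L))
      · obtain ⟨d, rfl⟩ := Nat.exists_eq_add_of_le (Nat.succ_le_of_lt hs)
        obtain ⟨e, he⟩ : ∃ e, n + 1 = d + 1 + e := ⟨n - d, by omega⟩
        rw [he]
        obtain ⟨h, ha, hb, hc⟩ := bag_after_empty s (d + 1) i (B i) rfl rfl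
        have h1 := windowed_across s (d + 1) e L
        have h2 := windowed_across (s + 1) d (e + 1) L
        rw [show s + (d + 1) = s.succ + d by omega] at h1
        rw [show d + (e + 1) = d + 1 + e by omega] at h2
        have hfin : (if s.succ + d + L.sum ≤ s + (d + 1 + e) ∧ s < s.succ + d + L.sum then F
            else V) = if e < L.sum then V else F := by
          split <;> split <;> first | rfl | omega
        rw [hfin, h1, h2]
        exact Pass.cons h rfl (pass_full L hL' e (s + 1) d _ ha hc)

/-- A site without baskets is final once only empty bags arrive; hence the condition on the sites in
`Columns`. -/
theorem empty_bag_fixed {S : Site} (hS : S = V ∨ S = F) :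
    carrierAfter (bag 0 0) S = bag 0 0 ∧ siteAfter (bag 0 0) S = S := by
  rcases hS with rfl | rfl
  · obtain ⟨h, ha, hb, hc⟩ := bag_after_empty 0 0 0 V rfl rfl
    exact ⟨h, site_eq ha hc⟩
  · obtain ⟨h, ha, hb, hc⟩ := bag_after_full 0 0 0 F rfl rfl
    exact ⟨h, site_eq ha hc⟩

theorem pass_replicate (d : ℕ) {S S' : Site} {w w' : List Carrier} (hS : S = V ∨ S = F)
    (h : Pass S w w' S') :
    Pass S (List.replicate d (bag 0 0) ++ w) (List.replicate d (bag 0 0) ++ w') S' := by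
  have hb := empty_bag_fixed hS
  induction d with
  | zero => exact h
  | succ d ih => exact Pass.cons hb.1 hb.2 ih

/-- The sites of the word `W` are passed by the bags `w`: the bags become `w'`, and the sites become
the word `W'`, which consists of sites without baskets. -/
inductive Columns : List Site → List Carrier → List Carrier → List Site → Prop
  | nil (w : List Carrier) : Columns [] w w []
  | cons {S S' : Site} {W W' : List Site} {w w₁ w' : List Carrier}
      (h : Pass S (w ++ [bag 0 0]) w₁ S') (hS : S' = V ∨ S' = F) (hW : Columns W w₁ w' W') :
      Columns (S :: W) w w' (S' :: W')

theorem Columns.append {W W' Z Z' : List Site} {w w₁ w' : List Carrier}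
    (h : Columns W w w₁ W') (h' : Columns Z w₁ w' Z') : Columns (W ++ Z) w w' (W' ++ Z') := by
  induction h with
  | nil => exact h'
  | cons h hS _ ih => exact Columns.cons h hS (ih h')

theorem columns_baskets (as L : List ℕ) :
    Columns (basketSoliton as) (baskets L) (baskets (as.reverse ++ L))
      (List.replicate as.length V) := by
  induction as generalizing L with
  | nil => exact Columns.nil _
  | cons a as ih =>
    rw [List.reverse_cons, List.append_assoc]
    exact Columns.cons (pass_baskets a L) (Or.inl rfl) (ih (a :: L))

theorem columns_vacuum (L : List ℕ) (d g : ℕ) :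
    Columns (List.replicate g V) (List.replicate d (bag 0 0) ++ baskets L)
      (List.replicate (d + g) (bag 0 0) ++ baskets L) (List.replicate g V) := by
  induction g generalizing d with
  | zero => exact Columns.nil _
  | succ g ih =>
    have h := pass_replicate d (Or.inl rfl) (pass_baskets 0 L)
    rw [← List.append_assoc] at h
    refine Columns.cons h (Or.inl rfl) ?_
    rw [show d + (g + 1) = d + 1 + g by ring]
    convert ih (d + 1) using 1
    simp [List.replicate_succ']

theorem columns_fast (L : List ℕ) (hL : ∀ k ∈ L, 1 ≤ k) (d n j : ℕ) :
    Columns (List.replicate j F) (List.replicate d (bag 0 0) ++ windowed L 0 n)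
      (List.replicate (d + j) (bag 0 0) ++ windowed L 0 (n + j))
      ((List.range' n j).map fun i => if i < L.sum then V else F) := by
  induction j generalizing d n with
  | zero => exact Columns.nil _
  | succ j ih =>
    have h := pass_replicate d (Or.inr rfl) (pass_full L hL n 0 0 F rfl rfl)
    rw [← List.append_assoc] at h
    rw [List.range'_succ, List.map_cons]
    refine Columns.cons h (by split <;> simp) ?_
    rw [show d + (j + 1) = d + 1 + j by ring, show n + (j + 1) = n + 1 + j by ring]
    convert ih (d + 1) (n + 1) using 1
    simp [List.replicate_succ']

theorem columns_windowed (L : List ℕ) (hL : ∀ k ∈ L, 1 ≤ k) (d n s j : ℕ) (hn : 1 ≤ n) :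
    Columns (List.replicate j V) (List.replicate d (bag 0 0) ++ windowed L s n)
      (List.replicate (d + j) (bag 0 0) ++ windowed L (s + j) n)
      ((List.range' s j).map fun i => if L.sum ≤ i + n ∧ i < L.sum then F else V) := by
  induction j generalizing d s with
  | zero => exact Columns.nil _
  | succ j ih =>
    have h := pass_replicate d (Or.inl rfl) (pass_windowed L hL n s 0 hn)
    rw [← List.append_assoc] at h
    rw [List.range'_succ, List.map_cons]
    refine Columns.cons h (by split <;> simp) ?_
    rw [show d + (j + 1) = d + 1 + j by ring, show s + (j + 1) = s + 1 + j by ring]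
    convert ih (d + 1) (s + 1) using 1
    simp [List.replicate_succ']

/-! ### From lists of bags to iterates of `T 0` -/

/-- In the course of the time evolution `T_0`, the bags of the list `w`, and then only empty bags,
arrive at site `i`. -/
def Sees (S : State) (i : ℤ) (w : List Carrier) : Prop :=
  ∀ t : ℕ, carrierAt 0 ((T 0)^[t] S) i = w.getD t (bag 0 0)

theorem getD_append_default {α : Type*} (w : List α) (d : α) (t : ℕ) :
    (w ++ [d]).getD t d = w.getD t d := by
  rcases lt_or_ge t w.length with h | h
  · rw [List.getD_append _ _ _ _ h]
  · rw [List.getD_append_right _ _ _ _ h, List.getD_eq_default w _ h]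
    cases t - w.length <;> simp

/-- The supply of empty bags is endless; one more is listed at each site so that the last baskets
can leave it. -/
theorem Sees.append_empty {S : State} {i : ℤ} {w : List Carrier} (h : Sees S i w) :
    Sees S i (w ++ [bag 0 0]) := fun t => by rw [h t, getD_append_default]

theorem Pass.length_eq {X X' : Site} {w w' : List Carrier} (h : Pass X w w' X') :
    w'.length = w.length := by
  induction h with
  | nil => rfl
  | cons _ _ _ ih => simp [ih]

theorem T_site (ℓ : ℕ∞) (S : State) (i : ℤ) :
    (T ℓ S).site i = siteAfter (carrierAt ℓ S i) (S.site i) := rfl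

/-- The head of the list is time 0, and the tail is the same situation for `T 0 S`. -/
theorem Sees.pass {X X' : Site} {w w' : List Carrier} (h : Pass X w w' X')
    (hX : X' = V ∨ X' = F) {S : State} {i : ℤ} (hw : Sees S i w) (hS : S.site i = X) :
    Sees S (i + 1) w' ∧ ∀ t ≥ w.length, ((T 0)^[t] S).site i = X' := by
  induction h generalizing S with
  | nil X =>
    have key : ∀ t, ((T 0)^[t] S).site i = X := by
      intro t
      induction t with
      | zero => exact hS
      | succ t ih =>
        rw [Function.iterate_succ_apply', T_site, hw t, ih]
        exact (empty_bag_fixed hX).2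
    refine ⟨fun t => ?_, fun t _ => key t⟩
    rw [carrierAt_succ, key, hw t]
    exact (empty_bag_fixed hX).1
  | @cons C C' X X₁ X₂ w w' hC hX₁ h ih =>
    have h0 : carrierAt 0 S i = C := hw 0
    obtain ⟨ih1, ih2⟩ := ih hX (S := T 0 S) (fun t => hw (t + 1)) (by rw [T_site, h0, hS, hX₁])
    constructor
    · rintro (_ | t)
      · rw [Function.iterate_zero_apply, carrierAt_succ, h0, hS, hC]
        rfl
      · exact ih1 t
    · rintro (_ | t) ht
      · simp at ht
      · exact ih2 t (by simpa using ht)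

theorem Columns.length_eq {W W' : List Site} {w w' : List Carrier} (h : Columns W w w' W') :
    W'.length = W.length := by
  induction h with
  | nil => rfl
  | cons _ _ _ ih => simp [ih]

/-- Each site lengthens the list by one bag, whence the time after which the whole word is settled.
-/
theorem Sees.columns {W W' : List Site} {w w' : List Carrier} (h : Columns W w w' W')
    {S : State} {i : ℤ} (hw : Sees S i w) (hS : ∀ j < W.length, S.site (i + j) = W.getD j V) :
    Sees S (i + W.length) w' ∧ ∀ t ≥ w.length + W.length, ∀ j < W.length,
      ((T 0)^[t] S).site (i + j) = W'.getD j V := by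
  induction h generalizing i with
  | nil => simpa using hw
  | @cons X X' W W' w w₁ w' h hX hW ih =>
    have h0 : S.site i = X := by simpa using hS 0 (by simp)
    obtain ⟨h1, h2⟩ := Sees.pass h hX hw.append_empty h0
    have hlen := h.length_eq
    rw [List.length_append, List.length_singleton] at hlen h2
    obtain ⟨h3, h4⟩ := ih h1 (fun j hj => by
      have := hS (j + 1) (by simpa using hj)
      rw [List.getD_cons_succ] at this
      rw [← this]
      congr 1
      push_cast
      ring)
    constructor
    · convert h3 using 1
      simp
      ring
    · rintro t ht (_ | j) hj
      · simpa using h2 t (by simp at ht; omega)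
      · have := h4 t (by simp at ht; omega) j (by simpa using hj)
        rw [List.getD_cons_succ, ← this]
        congr 1
        push_cast
        ring

/-- States that agree to the right of `n`, and there receive the same carriers, continue to
agree. -/
theorem iterate_site_eq (n : ℤ) (S S' : State) (h : ∀ i ≥ n, S.site i = S'.site i)
    (hc : ∀ t : ℕ, carrierAt 0 ((T 0)^[t] S) n = carrierAt 0 ((T 0)^[t] S') n) (t : ℕ) :
    ∀ i ≥ n, ((T 0)^[t] S).site i = ((T 0)^[t] S').site i := by
  induction t generalizing S S' with
  | zero => exact h
  | succ t ih =>
    have key : ∀ i ≥ n, carrierAt 0 S i = carrierAt 0 S' i := by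
      intro i hi
      induction i, hi using Int.leInduction with
      | base => exact hc 0
      | succ i hi ihi => rw [carrierAt_succ, carrierAt_succ, ihi, h i hi]
    refine ih (T 0 S) (T 0 S') (fun i hi => ?_) (fun t => hc (t + 1))
    rw [T_site, T_site, key i hi, h i hi]

theorem iterate_vacuum (ℓ : ℕ∞) (n : ℤ) (S : State) (h : ∀ i < n, S.site i = V) (t : ℕ) :
    ∀ i < n, ((T ℓ)^[t] S).site i = V := by
  induction t with
  | zero => exact h
  | succ t ih =>
    intro i hi
    rw [Function.iterate_succ_apply', T_site, carrierAt_of_vacuum ℓ _ n ih i hi.le, ih i hi]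
    exact (u_V ℓ).1

theorem sees_place (W : List Site) (x : ℤ) : Sees (place W x) x [] := fun t => by
  rw [carrierAt_of_vacuum 0 _ x (iterate_vacuum 0 x _ (fun i hi => if_neg (by omega)) t) x le_rfl,
    u_zero]
  rfl

theorem place_site_add (W : List Site) (x : ℤ) (j : ℕ) :
    (place W x).site (x + j) = W.getD j V := by
  rw [place_site, if_pos (by omega)]
  congr
  omega

theorem place_site_right (W : List Site) (x i : ℤ) (h : x + W.length ≤ i) :
    (place W x).site i = V := by
  rw [place_site, if_pos (by omega), List.getD_eq_default _ _ (by omega)]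

theorem place_append_site (W W' : List Site) (x i : ℤ) :
    (place (W ++ W') x).site i = if i < x + W.length then (place W x).site i
      else (place W' (x + W.length)).site i := by
  simp only [place_site]
  by_cases h : x ≤ i
  · by_cases h' : i < x + W.length
    · rw [if_pos h, if_pos h', if_pos h, List.getD_append _ _ _ _ (by omega)]
    · rw [if_pos h, if_neg h', if_pos (by omega), List.getD_append_right _ _ _ _ (by omega)]
      congr 1
      omega
  · rw [if_neg h, if_pos (by omega), if_neg h]

/-! ### The collision under `T 0` -/

/-- The outputs of the fast soliton and of the a vacuum sites behind it fit together: position j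
holds a ball exactly when a ≤ j. -/
theorem final_columns (a m : ℕ) :
    ((List.range' 0 m).map fun i => if i < a then V else F) ++
      ((List.range' 0 a).map fun i => if a ≤ i + m ∧ i < a then F else V) =
    List.replicate a V ++ List.replicate m F := by
  refine List.ext_getElem (by simp; omega) fun j h1 h2 => ?_
  simp only [List.getElem_append, List.getElem_map, List.getElem_range', List.getElem_replicate,
    List.length_map, List.length_range', List.length_replicate] at h1 h2 ⊢
  simp at h1 h2
  split <;> split <;> split <;> first | rfl | omega

theorem basketSoliton_length (as : List ℕ) : (basketSoliton as).length = as.length := by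
  simp [basketSoliton]

theorem iterate_basketSoliton (ℓ : ℕ∞) (as : List ℕ) (x : ℤ) (t : ℕ) :
    (T ℓ)^[t] (place (basketSoliton as) x) = place (basketSoliton as) (x + t) := by
  induction t with
  | zero => simp
  | succ t ih =>
    rw [Function.iterate_succ_apply', ih, T_basketSoliton]
    congr 1
    push_cast
    ring

/-- Under `T_0` the fast soliton is at rest. A pure basket soliton passes it from left to right. -/
theorem iterate_zero_basket_fast (as : List ℕ) (hpos : ∀ a ∈ as, 1 ≤ a) (m : ℕ) (hm : 1 ≤ m)
    (y : ℤ) (g : ℕ) :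
    (T 0)^[as.length + m + as.sum + (g + 1)]
        (place (separated (basketSoliton as) 1 (fastSoliton m)) y) =
      place (separated (fastSoliton m) (g + 1) (basketSoliton as))
        (y + (as.length + 1 + as.sum)) := by
  set t := as.length + m + as.sum + (g + 1) with ht
  have hpos' : ∀ a ∈ as.reverse, 1 ≤ a := by simpa using hpos
  let S := place (separated (basketSoliton as) 1 (fastSoliton m)) y
  -- A free basket soliton for comparison: it sends the same bags past the interaction region.
  let S' := place (basketSoliton as) (y + 1)
  have hS : S = place (basketSoliton as ++ List.replicate 1 V ++ fastSoliton m ++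
      List.replicate as.sum V) y := (place_append_vacuum _ _ _).symm
  have hS' : S' = place (List.replicate 1 V ++ basketSoliton as ++
      List.replicate (m + as.sum) V) y := by
    rw [place_append_vacuum, place_vacuum_append]
    rfl
  have hc : Columns (basketSoliton as ++ List.replicate 1 V ++ fastSoliton m ++
      List.replicate as.sum V) []
      (List.replicate (m + as.sum) (bag 0 0) ++ (baskets as.reverse ++ [bag 0 0]))
      (List.replicate as.length V ++ List.replicate 1 V ++ (List.replicate as.sum V ++
        List.replicate m F)) := by
    have h1 := columns_baskets as []
    have h2 := columns_vacuum as.reverse 0 1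
    have h3 := columns_fast as.reverse hpos' 0 0 m
    have h4 := columns_windowed as.reverse hpos' m m 0 as.sum hm
    simp only [List.sum_reverse, zero_add] at h1 h2 h3 h4
    have hw := windowed_sum as.reverse m
    rw [List.sum_reverse] at hw
    rw [hw] at h4
    -- The separating vacuum site has put an empty slot in front of the row, which makes it a window
    -- of length 0.
    rw [windowed_zero _ hpos'] at h3
    rw [List.append_nil] at h1
    rw [← final_columns, ← List.append_assoc (List.replicate as.length V ++ _)]
    exact ((h1.append h2).append h3).append h4
  have hc' : Columns (List.replicate 1 V ++ basketSoliton as ++ List.replicate (m + as.sum) V) []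
      (List.replicate (m + as.sum) (bag 0 0) ++ (baskets as.reverse ++ [bag 0 0]))
      (List.replicate 1 V ++ List.replicate as.length V ++ List.replicate (m + as.sum) V) := by
    have h1 := columns_vacuum [] 0 1
    have h2 := columns_baskets as [0]
    have h3 := columns_vacuum (as.reverse ++ [0]) 0 (m + as.sum)
    rw [zero_add] at h3
    have := (h1.append h2).append h3
    simpa [baskets] using this
  obtain ⟨s1, s2⟩ := Sees.columns hc (sees_place _ y) (fun j _ => place_site_add _ y j)
  obtain ⟨s1', -⟩ := Sees.columns hc' (sees_place _ y) (fun j _ => place_site_add _ y j)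
  rw [← hS] at s1 s2
  rw [← hS'] at s1'
  simp only [List.length_append, List.length_replicate, basketSoliton_length, fastSoliton,
    List.length_nil] at s1 s2 s1'
  set n : ℤ := y + (as.length + 1 + m + as.sum) with hn
  rw [show y + ((as.length + 1 + m + as.sum : ℕ) : ℤ) = n by omega] at s1
  rw [show y + ((1 + as.length + (m + as.sum) : ℕ) : ℤ) = n by omega] at s1'
  -- To the right of n both states start as vacuum and receive equal bags.
  have hright := iterate_site_eq n S S'
    (fun i hi => by
      rw [place_site_right _ _ _ (by
          simp [separated, basketSoliton_length, fastSoliton]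
          omega),
        place_site_right _ _ _ (by
          simp [basketSoliton_length]
          omega)])
    (fun t => by rw [s1 t, s1' t]) t
  rw [iterate_basketSoliton] at hright
  have hleft := iterate_vacuum 0 y S (fun i hi => if_neg (by omega)) t
  ext i : 2
  change ((T 0)^[t] S).site i = (place (fastSoliton m ++ List.replicate (g + 1) V ++
    basketSoliton as) _).site i
  rw [List.append_assoc, place_append_site, place_vacuum_append]
  have hlen : (fastSoliton m).length = m := by simp [fastSoliton]
  rw [hlen]
  split
  · rcases lt_or_ge i y with hi | hi
    · rw [place_site, if_neg (by omega)]
      exact hleft i hi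
    · obtain ⟨j, rfl⟩ : ∃ j : ℕ, i = y + j := ⟨(i - y).toNat, by omega⟩
      refine (s2 t (by omega) j (by omega)).trans ?_
      rcases lt_or_ge j (as.length + 1 + as.sum) with hj | hj
      · rw [place_site, if_neg (by omega), ← List.append_assoc, ← List.replicate_add,
          ← List.replicate_add, List.getD_append _ _ _ _ (by simpa using hj)]
        simp
      · rw [place_site, if_pos (by omega), ← List.append_assoc, ← List.replicate_add,
          ← List.replicate_add, List.getD_append_right _ _ _ _ (by simpa using hj)]
        rw [fastSoliton]
        congr 1
        rw [List.length_replicate]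
        omega
  · rw [show y + (as.length + 1 + as.sum : ℤ) + m + ((g + 1 : ℕ) : ℤ) = y + 1 + t by
      omega]
    exact hright i (by omega)

/-! ### Separation under `T ℓ`, approach under `T 0`, and conclusion -/

theorem iterate_basket_fast {ℓ : ℕ∞} {m d : ℕ} (hv : ((d + 1 : ℕ) : ℕ∞) = min ℓ m) (as : List ℕ)
    (y : ℤ) (N : ℕ) :
    (T ℓ)^[N] (place (separated (basketSoliton as) 1 (fastSoliton m)) y) =
      place (separated (basketSoliton as) (N * d + 1) (fastSoliton m)) (y + N) := by
  induction N with
  | zero => simp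
  | succ N ih =>
    rw [Function.iterate_succ_apply', ih, T_basket_fast hv]
    congr 1
    · rw [show N * d + (d + 1) = (N + 1) * d + 1 by ring]
    · push_cast
      ring

theorem iterate_zero_approach (as : List ℕ) (m g : ℕ) (y : ℤ) (M : ℕ) :
    (T 0)^[M] (place (separated (basketSoliton as) (g + M) (fastSoliton m)) y) =
      place (separated (basketSoliton as) g (fastSoliton m)) (y + M) := by
  induction M generalizing y with
  | zero => simp
  | succ M ih =>
    rw [Function.iterate_succ_apply, ← add_assoc,
      T_basket_fast (ℓ := 0) (v := 0) (by simp), add_zero, ih]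
    congr 1
    push_cast
    ring

end BoxBasketBall

theorem mainTheorem6 (ℓ : ℕ∞) (hℓ : 2 ≤ ℓ) (m : ℕ) (hm : 2 ≤ m)
    (as : List ℕ) (has : as ≠ []) (hpos : ∀ a ∈ as, 1 ≤ a) :
    BoxBasketBall.Scatters (BoxBasketBall.T ℓ)
      (BoxBasketBall.fastSoliton m) (BoxBasketBall.basketSoliton as)
      (-1) (-(as.sum : ℤ)) := by
  open BoxBasketBall in
  obtain ⟨d, hv⟩ : ∃ d : ℕ, ((d + 1 + 1 : ℕ) : ℕ∞) = min ℓ m := by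
    obtain ⟨v, hv⟩ := ENat.ne_top_iff_exists.1
      (ne_top_of_le_ne_top (ENat.natCast_ne_top m) (min_le_right ℓ (m : ℕ∞)))
    have h2 : (2 : ℕ∞) ≤ v := hv ▸ le_min hℓ (by exact_mod_cast hm)
    obtain ⟨d, rfl⟩ := Nat.exists_eq_add_of_le' (show 2 ≤ v by exact_mod_cast h2)
    exact ⟨d, hv⟩
  refine ⟨((d + 1 + 1 : ℕ) : ℤ), 1, T_fastSoliton hv, T_basketSoliton ℓ as, fun x x' g hg hx => ?_⟩
  obtain ⟨g, rfl⟩ := Nat.exists_eq_add_of_le' (show 1 ≤ g by omega)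
  have hlen : (fastSoliton m).length = m := by simp [fastSoliton]
  have hlen' := basketSoliton_length as
  rw [hlen] at hx
  -- The time that `T 0` needs to carry the baskets through the balls and to the prescribed gap g +
  -- 1 beyond them.
  set M := as.length + m + as.sum + (g + 1) with hM
  -- `T ℓ` opens the gap to N(d + 1) + 1, and `T 0` closes it by M; N ≥ M keeps it positive.
  refine ⟨M, fun N hN => ⟨N * d + (N - M) + 1, ?_, ?_⟩⟩
  · rw [hlen', hx]
    have hmul : ((N * d : ℕ) : ℤ) = N * d := Nat.cast_mul N d
    rw [show (N : ℤ) * ((d + 1 + 1 : ℕ) : ℤ) = N * d + N + N by push_cast; ring]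
    omega
  -- Start the baskets where the collision leaves the balls at x.
  · have h := iterate_zero_basket_fast as hpos m (by omega) (x - (as.length + 1 + as.sum)) g
    rw [sub_add_cancel] at h
    rw [← h, ← ((Function.Commute.iterate_iterate (f := T 0) (g := T ℓ) (T_comm ℓ) M N) _),
      iterate_basket_fast hv,
      show N * (d + 1) + 1 = N * d + (N - M) + 1 + M by rw [mul_add]; omega,
      iterate_zero_approach]
    congr 1
    omega
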